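/- Let $A\in\mathbb R_{\ge 0}^{m\times n}$ and $b\in\mathbb R_{\ge 0}^m$. For $j\in[m]$ let $K(j)=\{x\in[0,1]^n:\sum_i A_{ji}x_i\le b_j\}$; for $S\subseteq[m]$ let $K(S)=\bigcap_{j\in S}K(j)$ and $K_I(S)=\operatorname{conv}(K(S)\cap\{0,1\}^n)$; and for $1\le t\le m$ let $P^t=\bigcap_{S\subseteq[m],\,|S|=t}K_I(S)$. An extended formulation $Q$ is a finite system of linear inequalities $Mx+Ny\le d$ in variables $x\in\mathbb R^n$ and auxiliary variables $y$; its size is the number of all variables plus the number of inequalities, and $\operatorname{proj}Q=\{x:\exists y,\ Mx+Ny\le d\}$. It is a $(1-\epsilon)$-approximate extended formulation of $X\subseteq\mathbb R^n$ if $(1-\epsilon)\operatorname{proj}Q\subseteq X\subseteq\operatorname{proj}Q$. There is an absolute constant $C>0$ such that for all $n$, all $1\le t\le m$, all $0<\epsilon\le1$ and all $A,b$ as above the following holds. Every $K_I(S)$ with $|S|=t$ has a $(1-\epsilon)$-approximate extended formulation $K_\epsilon(S)$ of size at most $C\,n^{t^3/\epsilon+1}$, and there is an extended formulation $Q$ with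 $\operatorname{proj}Q=\bigcap_{|S|=t}\operatorname{proj}K_\epsilon(S)$ such that: 1. $Q$ is a $(1-\epsilon)$-approximate extended formulation of $P^t$; 2. the size of $Q$ is at most $C\,m^t\,n^{t^3/\epsilon+1}$; in particular, if $m\le c\,n$, it is at most $C\,c^t\,n^{t^3/\epsilon+t+1}$, which is $O(n^{t^3/\epsilon+t+1})$ when $m=O(n)$ and $t$ is fixed; 3. for every $w\in\mathbb R_{\ge0}^n$ the maxima $v_P=\max\{w^Tx:x\in P^t\}$ and $v_Q=\max\{w^Tx:x\in\operatorname{proj}Q\}$ are attained and satisfy $v_P\le v_Q$, $(1-\epsilon)v_Q\le v_P$ and, if $\epsilon<1$, $v_Q\le\frac1{1-\epsilon}v_P$. -/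

import Mathlib

namespace KnapsackHierarchy

/-- The knapsack polytope `K(j) = {x ∈ [0,1]ⁿ : ∑ i, a^j_i x_i ≤ b^j}` of row `j`. -/
def knapsack {m n : ℕ} (A : Matrix (Fin m) (Fin n) ℝ) (b : Fin m → ℝ) (j : Fin m) :
    Set (Fin n → ℝ) :=
  {x | (∀ i, 0 ≤ x i ∧ x i ≤ 1) ∧ ∑ i, A j i * x i ≤ b j}

/-- `K(S) = ⋂_{j ∈ S} K(j)`. -/
def knapsackInter {m n : ℕ} (A : Matrix (Fin m) (Fin n) ℝ) (b : Fin m → ℝ)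
    (S : Finset (Fin m)) : Set (Fin n → ℝ) :=
  ⋂ j ∈ S, knapsack A b j

/-- The set `{0,1}ⁿ`. -/
def binaryPoints (n : ℕ) : Set (Fin n → ℝ) :=
  {x | ∀ i, x i = 0 ∨ x i = 1}

/-- The integer hull `K_I(S) = conv (K(S) ∩ {0,1}ⁿ)`. -/
def integerHull {m n : ℕ} (A : Matrix (Fin m) (Fin n) ℝ) (b : Fin m → ℝ)
    (S : Finset (Fin m)) : Set (Fin n → ℝ) :=
  convexHull ℝ (knapsackInter A b S ∩ binaryPoints n)

/-- Level `t` of the knapsack intersection hierarchy, `P^t = ⋂_{|S| = t} K_I(S)`. -/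
def hierarchy {m n : ℕ} (A : Matrix (Fin m) (Fin n) ℝ) (b : Fin m → ℝ) (t : ℕ) :
    Set (Fin n → ℝ) :=
  ⋂ S : {S : Finset (Fin m) // S.card = t}, integerHull A b S.1

/-- An extended formulation over `ℝⁿ`: a finite system `M x + N y ≤ d` of linear inequalities
in the original variables `x ∈ ℝⁿ` and auxiliary variables `y ∈ ℝ^numAux`. (An equation is
written as two inequalities.) -/
structure ExtendedFormulation (n : ℕ) where
  numAux : ℕ
  numIneq : ℕ
  M : Matrix (Fin numIneq) (Fin n) ℝ
  N : Matrix (Fin numIneq) (Fin numAux) ℝ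
  d : Fin numIneq → ℝ

namespace ExtendedFormulation

/-- The projection of the formulation onto the original variables. -/
def proj {n : ℕ} (Q : ExtendedFormulation n) : Set (Fin n → ℝ) :=
  {x | ∃ y : Fin Q.numAux → ℝ,
    ∀ i, ∑ k, Q.M i k * x k + ∑ l, Q.N i l * y l ≤ Q.d i}

/-- The size: total number of variables plus number of inequalities. -/
def size {n : ℕ} (Q : ExtendedFormulation n) : ℕ :=
  n + Q.numAux + Q.numIneq

/-- `Q` is a polyhedral `(1 - ε)`-approximate extended formulation of `X`:
`(1 - ε) proj Q ⊆ X ⊆ proj Q`. -/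
def IsApprox {n : ℕ} (Q : ExtendedFormulation n) (ε : ℝ) (X : Set (Fin n → ℝ)) : Prop :=
  (∀ x ∈ Q.proj, (1 - ε) • x ∈ X) ∧ X ⊆ Q.proj

end ExtendedFormulation

end KnapsackHierarchy

/-!
Each integer hull `K_I(S)` is approximated by a disjunction of polytopes over guesses of heavy
items. Put `g = ⌈t / ε⌉ - 1`. For every row `j ∈ S`, guess the `g t` heaviest items of a feasible
set, arranged in `g` groups of `t`; fix them to `1`, fix to `0` every other item that is heavier in some
row than an item guessed for that row, and relax the remaining items to `[0,1]`, keeping the `t`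
knapsack rows. Together with the sets of at most `g t` items, which are disjuncts by themselves,
these polytopes cover all feasible sets (`exists_guess`), and there are at most
`3 n ^ (t g t) ≤ 3 n ^ (t³ / ε)` of them.

The relaxation loses little. An extreme point `z` of such a polytope has at most `t` fractional
coordinates (`card_fractional_le`), and each fractional item is in every row no heavier than the
items guessed for that row. So the fractional items all fit in if one group per row is removed.
Choosing among the `g` groups, or rounding all fractional items down, gives `g + 1` feasible sets
whose average dominates `(1 - ε) z` (`smul_mem_convexHull_of_groups`); since integer hulls of
packing constraints are closed under decreasing a nonnegative vector (`mem_convexHull_of_le`), `(1 - ε) z`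
lies in `K_I(S)`.

Balas' formulation of the convex hull of a union of polytopes (`disjunctiveFormulation`) turns the
disjunction into one linear system, of size at most `11 n` times the number of disjuncts as long as
there are at most `n` rows. This fails only if `t > n`. More generally, if `t³ / ε ≥ n`, then
the convex hull of the at most `2 ^ n` feasible sets is itself small enough. Concatenating the
systems of all `S` gives `Q`. All projections are compact, so the optima are attained.
-/

namespace KnapsackHierarchy

/-! ### Constructing extended formulations -/

namespace ExtendedFormulation

/-- The extended formulation given by the inequalities `φ i x + ψ i y ≤ d i`, where the auxiliary
variables `y` and the inequalities are indexed by arbitrary finite types. -/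
noncomputable def ofFunctionals {n : ℕ} {α β : Type*} [Fintype α] [Fintype β] [DecidableEq α]
    (φ : β → (Fin n → ℝ) →ₗ[ℝ] ℝ) (ψ : β → (α → ℝ) →ₗ[ℝ] ℝ) (d : β → ℝ) :
    ExtendedFormulation n where
  numAux := Fintype.card α
  numIneq := Fintype.card β
  M := fun i k => φ ((Fintype.equivFin β).symm i) (Pi.single k 1)
  N := fun i l => ψ ((Fintype.equivFin β).symm i) (Pi.single ((Fintype.equivFin α).symm l) 1)
  d := fun i => d ((Fintype.equivFin β).symm i)

theorem sum_single_mul {γ : Type*} [Fintype γ] [DecidableEq γ] (f : (γ → ℝ) →ₗ[ℝ] ℝ)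
    (y : γ → ℝ) : ∑ l, f (Pi.single l 1) * y l = f y := by
  rw [LinearMap.pi_apply_eq_sum_univ f y]
  refine Finset.sum_congr rfl fun l _ => ?_
  rw [smul_eq_mul, mul_comm]
  congr 2
  ext k
  simp [Pi.single_apply, eq_comm]

theorem mem_proj_ofFunctionals {n : ℕ} {α β : Type*} [Fintype α] [Fintype β] [DecidableEq α]
    (φ : β → (Fin n → ℝ) →ₗ[ℝ] ℝ) (ψ : β → (α → ℝ) →ₗ[ℝ] ℝ) (d : β → ℝ) (x : Fin n → ℝ) :
    x ∈ (ofFunctionals φ ψ d).proj ↔ ∃ y : α → ℝ, ∀ i, φ i x + ψ i y ≤ d i := by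
  constructor
  · rintro ⟨y : Fin (Fintype.card α) → ℝ, hy⟩
    refine ⟨fun l => y (Fintype.equivFin α l), fun i => ?_⟩
    have h := hy (Fintype.equivFin β i)
    simp only [ofFunctionals, Equiv.symm_apply_apply] at h
    rw [sum_single_mul] at h
    rw [← sum_single_mul (ψ i), ← Equiv.sum_comp (Fintype.equivFin α).symm]
    simp only [Equiv.apply_symm_apply]
    exact h
  · rintro ⟨y, hy⟩
    refine ⟨fun l => y ((Fintype.equivFin α).symm l), fun i => ?_⟩
    have h := hy ((Fintype.equivFin β).symm i)
    rw [← sum_single_mul (φ _), ← sum_single_mul (ψ _), ← Equiv.sum_comp (Fintype.equivFin α).symm]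
      at h
    exact h

/-- The intersection of finitely many extended formulations: the systems are concatenated, each
with its own copy of its auxiliary variables. -/
noncomputable def inter {n : ℕ} {ι : Type*} [Fintype ι] [DecidableEq ι]
    (K : ι → ExtendedFormulation n) : ExtendedFormulation n :=
  ofFunctionals (α := Σ s, Fin (K s).numAux) (β := Σ s, Fin (K s).numIneq)
    (fun p => ∑ k, (K p.1).M p.2 k • LinearMap.proj k)
    (fun p => ∑ l, (K p.1).N p.2 l • LinearMap.proj ⟨p.1, l⟩)
    (fun p => (K p.1).d p.2)

theorem proj_inter {n : ℕ} {ι : Type*} [Fintype ι] [DecidableEq ι]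
    (K : ι → ExtendedFormulation n) : (inter K).proj = ⋂ s, (K s).proj := by
  ext x
  rw [inter, mem_proj_ofFunctionals]
  simp only [LinearMap.coe_sum, Finset.sum_apply, LinearMap.smul_apply, LinearMap.proj_apply,
    smul_eq_mul, Set.mem_iInter, proj, Set.mem_ofPred_eq]
  constructor
  · rintro ⟨y, hy⟩ s
    exact ⟨fun l => y ⟨s, l⟩, fun i => hy ⟨s, i⟩⟩
  · intro h
    choose y hy using h
    exact ⟨fun p => y p.1 p.2, fun p => hy p.1 p.2⟩

theorem size_inter_le {n : ℕ} {ι : Type*} [Fintype ι] [DecidableEq ι] [Nonempty ι]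
    (K : ι → ExtendedFormulation n) : (inter K).size ≤ ∑ s, (K s).size := by
  have hn : n ≤ ∑ _s : ι, n := by
    simpa using Nat.le_mul_of_pos_left n (Fintype.card_pos (α := ι))
  simp only [size, inter, ofFunctionals, Fintype.card_sigma, Fintype.card_fin,
    Finset.sum_add_distrib]
  lia

theorem convex_proj {n : ℕ} (Q : ExtendedFormulation n) : Convex ℝ Q.proj := by
  rintro x ⟨y, hy⟩ x' ⟨y', hy'⟩ p q hp hq hpq
  refine ⟨p • y + q • y', fun i => ?_⟩
  have h := add_le_add (mul_le_mul_of_nonneg_left (hy i) hp)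
    (mul_le_mul_of_nonneg_left (hy' i) hq)
  rw [← add_mul, hpq, one_mul] at h
  refine le_trans (le_of_eq ?_) h
  simp only [Pi.add_apply, Pi.smul_apply, smul_eq_mul, mul_add, Finset.sum_add_distrib,
    Finset.mul_sum]
  simp only [mul_left_comm p, mul_left_comm q]
  ring

end ExtendedFormulation

/-! ### Convex hulls of unions of box-constrained polytopes -/

section Disjunction

variable {n : ℕ} {R D : Type*} [Fintype R] [Fintype D]

/-- The polytope `{x : l ≤ x ≤ u, a x ≤ β}`. -/
def boxPolytope (a : R → Fin n → ℝ) (β : R → ℝ) (l u : Fin n → ℝ) : Set (Fin n → ℝ) :=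
  {x | l ≤ x ∧ x ≤ u ∧ ∀ r, ∑ i, a r i * x i ≤ β r}

/-- The homogenised pieces of Balas' formulation of `conv (⋃ d, boxPolytope a β (l d) (u d))`:
a weight `lam d` for each disjunct `d`, and a point `X d` of the `lam d`-fold dilate of this
disjunct. -/
def disjunctivePieces (a : R → Fin n → ℝ) (β : R → ℝ) (l u : D → Fin n → ℝ) :
    Set ((D → Fin n → ℝ) × (D → ℝ)) :=
  {p | (∀ d, 0 ≤ p.2 d) ∧ ∑ d, p.2 d = 1 ∧
    ∀ d, (∀ i, p.2 d * l d i ≤ p.1 d i) ∧ (∀ i, p.1 d i ≤ p.2 d * u d i) ∧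
      ∀ r, ∑ i, a r i * p.1 d i ≤ p.2 d * β r}

/-- Balas' formulation of the convex hull of the union of the polytopes
`boxPolytope a β (l d) (u d)`. The auxiliary variable `(d, some i)` is the `i`-th coordinate of the
piece in the disjunct `d`, and `(d, none)` is the weight of `d`. -/
noncomputable def disjunctiveFormulation [DecidableEq D] (a : R → Fin n → ℝ) (β : R → ℝ)
    (l u : D → Fin n → ℝ) : ExtendedFormulation n :=
  ExtendedFormulation.ofFunctionals (α := D × Option (Fin n))
    (β := (Fin n ⊕ Fin n) ⊕ (Unit ⊕ Unit) ⊕ D × (Unit ⊕ Fin n ⊕ Fin n ⊕ R))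
    (Sum.elim (Sum.elim (fun i => LinearMap.proj i) (fun i => -LinearMap.proj i)) 0)
    (Sum.elim
      (Sum.elim (fun i => -∑ d, LinearMap.proj (d, some i))
        (fun i => ∑ d, LinearMap.proj (d, some i)))
      (Sum.elim
        (Sum.elim (fun _ => ∑ d, LinearMap.proj (d, none))
          (fun _ => -∑ d, LinearMap.proj (d, none)))
        (fun p => Sum.elim (fun _ => -LinearMap.proj (p.1, none))
          (Sum.elim
            (fun i => l p.1 i • LinearMap.proj (p.1, none) - LinearMap.proj (p.1, some i))
            (Sum.elim
              (fun i => LinearMap.proj (p.1, some i) - u p.1 i • LinearMap.proj (p.1, none))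
              (fun r => ∑ i, a r i • LinearMap.proj (p.1, some i)
                - β r • LinearMap.proj (p.1, none)))) p.2)))
    (Sum.elim 0 (Sum.elim (Sum.elim 1 (-1)) 0))

theorem proj_disjunctiveFormulation [DecidableEq D] (a : R → Fin n → ℝ) (β : R → ℝ)
    (l u : D → Fin n → ℝ) :
    (disjunctiveFormulation a β l u).proj =
      (fun p : (D → Fin n → ℝ) × (D → ℝ) => ∑ d, p.1 d) '' disjunctivePieces a β l u := by
  ext x
  rw [disjunctiveFormulation, ExtendedFormulation.mem_proj_ofFunctionals]
  simp only [Sum.forall, Prod.forall, Sum.elim_inl, Sum.elim_inr, Pi.zero_apply, Pi.one_apply,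
    Pi.neg_apply, LinearMap.neg_apply, LinearMap.sub_apply, LinearMap.smul_apply,
    LinearMap.proj_apply, LinearMap.coe_sum, Finset.sum_apply, LinearMap.zero_apply, smul_eq_mul,
    zero_add, forall_const]
  constructor
  · rintro ⟨y, ⟨h1, h2⟩, ⟨h3, h4⟩, h5⟩
    refine ⟨(fun d i => y (d, some i), fun d => y (d, none)), ⟨fun d => ?_, ?_, fun d => ?_⟩, ?_⟩
    · linarith [(h5 d).1]
    · exact le_antisymm h3 (by linarith)
    · obtain ⟨-, h6, h7, h8⟩ := h5 d
      refine ⟨fun i => ?_, fun i => ?_, fun r => ?_⟩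
      · show y (d, none) * l d i ≤ y (d, some i)
        linarith [h6 i, mul_comm (y (d, none)) (l d i)]
      · show y (d, some i) ≤ y (d, none) * u d i
        linarith [h7 i, mul_comm (y (d, none)) (u d i)]
      · show ∑ i, a r i * y (d, some i) ≤ y (d, none) * β r
        linarith [h8 r, mul_comm (y (d, none)) (β r)]
    · ext i
      simp only [Finset.sum_apply]
      exact le_antisymm (by linarith [h2 i]) (by linarith [h1 i])
  · rintro ⟨⟨X, lam⟩, ⟨h1, h2, h3⟩, rfl⟩
    simp only at h1 h2 h3
    refine ⟨fun q => q.2.elim (lam q.1) (X q.1), ⟨fun i => ?_, fun i => ?_⟩, ⟨?_, ?_⟩, fun d => ?_⟩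
    · simp
    · simp
    · simp [h2]
    · simp [h2]
    · obtain ⟨h6, h7, h8⟩ := h3 d
      refine ⟨?_, fun i => ?_, fun i => ?_, fun r => ?_⟩
      · simpa using h1 d
      · simpa [mul_comm] using h6 i
      · simpa [mul_comm] using h7 i
      · simpa [mul_comm] using h8 r

theorem size_disjunctiveFormulation_le [DecidableEq D] [Nonempty D] (a : R → Fin n → ℝ)
    (β : R → ℝ) (l u : D → Fin n → ℝ) (hn : 1 ≤ n) (hR : Fintype.card R ≤ n) :
    (disjunctiveFormulation a β l u).size ≤ 11 * (n * Fintype.card D) := by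
  simp only [ExtendedFormulation.size, disjunctiveFormulation, ExtendedFormulation.ofFunctionals,
    Fintype.card_sum, Fintype.card_prod, Fintype.card_option, Fintype.card_fin, Fintype.card_unit]
  have hD : 1 ≤ Fintype.card D := Fintype.card_pos
  nlinarith [Nat.mul_le_mul_left (Fintype.card D) hR, Nat.mul_le_mul_left (Fintype.card D) hn,
    Nat.mul_le_mul_left n hD]

theorem isCompact_proj_disjunctiveFormulation [DecidableEq D] (a : R → Fin n → ℝ) (β : R → ℝ)
    (l u : D → Fin n → ℝ) (hl : ∀ d, 0 ≤ l d) (hu : ∀ d, u d ≤ 1) :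
    IsCompact (disjunctiveFormulation a β l u).proj := by
  rw [proj_disjunctiveFormulation]
  refine IsCompact.image ?_ (by fun_prop)
  refine (isCompact_Icc (a := (0 : (D → Fin n → ℝ) × (D → ℝ))) (b := 1)).of_isClosed_subset ?_ ?_
  · simp only [disjunctivePieces, Set.ofPred_and, Set.ofPred_forall]
    refine (isClosed_iInter fun d => isClosed_le (by fun_prop) (by fun_prop)).inter
      ((isClosed_eq (by fun_prop) (by fun_prop)).inter (isClosed_iInter fun d =>
        (isClosed_iInter fun i => isClosed_le (by fun_prop) (by fun_prop)).inter
        ((isClosed_iInter fun i => isClosed_le (by fun_prop) (by fun_prop)).inter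
        (isClosed_iInter fun r => isClosed_le (by fun_prop) (by fun_prop)))))
  · rintro ⟨X, lam⟩ ⟨h1, h2, h3⟩
    simp only at h1 h2 h3
    have h4 : ∀ d, lam d ≤ 1 := fun d =>
      h2 ▸ Finset.single_le_sum (fun d _ => h1 d) (Finset.mem_univ d)
    refine ⟨⟨fun d i => ?_, h1⟩, ⟨fun d i => ?_, h4⟩⟩
    · exact (mul_nonneg (h1 d) (hl d i)).trans ((h3 d).1 i)
    · exact ((h3 d).2.1 i).trans
        ((mul_le_of_le_one_right (h1 d) (hu d i)).trans (h4 d))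

theorem boxPolytope_subset_proj [DecidableEq D] (a : R → Fin n → ℝ) (β : R → ℝ)
    (l u : D → Fin n → ℝ) (d : D) :
    boxPolytope a β (l d) (u d) ⊆ (disjunctiveFormulation a β l u).proj := by
  rintro x ⟨h1, h2, h3⟩
  rw [proj_disjunctiveFormulation]
  refine ⟨(Pi.single d x, Pi.single d 1), ⟨fun e => ?_, by simp, fun e => ?_⟩, by simp⟩
  · by_cases h : e = d
    · subst h; simp
    · simp [h]
  · by_cases h : e = d
    · subst h; simpa using ⟨h1, h2, h3⟩
    · simp [h]

/-- A convex set that contains the dilates `c • P` of all disjuncts `P` contains the dilate of the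
whole projection. A disjunct of weight zero contributes nothing, since its piece lies between the
bounds `0 * l d` and `0 * u d`. -/
theorem smul_mem_of_mem_proj [DecidableEq D] (a : R → Fin n → ℝ) (β : R → ℝ)
    (l u : D → Fin n → ℝ) {Y : Set (Fin n → ℝ)} (hY : Convex ℝ Y) (c : ℝ)
    (h : ∀ d, ∀ x ∈ boxPolytope a β (l d) (u d), c • x ∈ Y) :
    ∀ x ∈ (disjunctiveFormulation a β l u).proj, c • x ∈ Y := by
  classical
  intro x hx
  rw [proj_disjunctiveFormulation] at hx
  obtain ⟨⟨X, lam⟩, ⟨h1, h2, h3⟩, rfl⟩ := hx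
  simp only at h1 h2 h3 ⊢
  have hzero : ∀ d, lam d = 0 → X d = 0 := by
    intro d hd
    ext i
    have h4 := (h3 d).1 i
    have h5 := (h3 d).2.1 i
    rw [hd, zero_mul] at h4 h5
    exact le_antisymm h5 h4
  have hX : c • ∑ d, X d = ∑ d with lam d ≠ 0, lam d • (c • ((lam d)⁻¹ • X d)) := by
    rw [Finset.smul_sum, Finset.sum_filter]
    refine Finset.sum_congr rfl fun d _ => ?_
    by_cases hd : lam d = 0
    · simp [hd, hzero d hd]
    · rw [if_pos hd, smul_comm c, smul_smul, mul_inv_cancel₀ hd, one_smul]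
  rw [hX]
  refine hY.sum_mem (fun d _ => h1 d) ?_ fun d hd => h d _ ?_
  · rw [Finset.sum_filter_ne_zero, h2]
  · have hpos : 0 < lam d := lt_of_le_of_ne (h1 d) (Ne.symm (by simpa using hd))
    obtain ⟨h4, h5, h6⟩ := h3 d
    refine ⟨fun i => ?_, fun i => ?_, fun r => ?_⟩
    · rw [Pi.smul_apply, smul_eq_mul, le_inv_mul_iff₀ hpos]
      exact h4 i
    · rw [Pi.smul_apply, smul_eq_mul, inv_mul_le_iff₀ hpos]
      exact h5 i
    · simp only [Pi.smul_apply, smul_eq_mul, mul_left_comm _ (lam d)⁻¹]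
      rw [← Finset.mul_sum, inv_mul_le_iff₀ hpos]
      exact h6 r

end Disjunction

/-! ### Hulls of packing families -/

/-- The characteristic vector of `T`. -/
noncomputable def charVec {n : ℕ} (T : Finset (Fin n)) : Fin n → ℝ :=
  fun i => if i ∈ T then 1 else 0

theorem charVec_nonneg {n : ℕ} (T : Finset (Fin n)) : 0 ≤ charVec T := fun i => by
  simp only [charVec, Pi.zero_apply]; split_ifs <;> norm_num

theorem charVec_le_one {n : ℕ} (T : Finset (Fin n)) : charVec T ≤ 1 := fun i => by
  simp only [charVec, Pi.one_apply]; split_ifs <;> norm_num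

/-- The sets of items that satisfy all the packing constraints `a x ≤ β`. -/
def packings {n : ℕ} {R : Type*} (a : R → Fin n → ℝ) (β : R → ℝ) : Set (Finset (Fin n)) :=
  {T | ∀ r, ∑ i ∈ T, a r i ≤ β r}

theorem sum_mul_charVec {n : ℕ} (a : Fin n → ℝ) (T : Finset (Fin n)) :
    ∑ i, a i * charVec T i = ∑ i ∈ T, a i := by
  simp [charVec]

theorem empty_mem_packings {n : ℕ} {R : Type*} {a : R → Fin n → ℝ} {β : R → ℝ}
    (hβ : ∀ r, 0 ≤ β r) : ∅ ∈ packings a β := fun r => by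
  simpa using hβ r

theorem isLowerSet_packings {n : ℕ} {R : Type*} {a : R → Fin n → ℝ} {β : R → ℝ}
    (ha : ∀ r i, 0 ≤ a r i) : IsLowerSet (packings a β) := fun _ _ hle h r =>
  (Finset.sum_le_sum_of_subset_of_nonneg hle fun i _ _ => ha r i).trans (h r)

theorem integerHull_eq {m n : ℕ} (A : Matrix (Fin m) (Fin n) ℝ) (b : Fin m → ℝ)
    (S : Finset (Fin m)) :
    integerHull A b S =
      convexHull ℝ (charVec '' packings (fun j : {j // j ∈ S} => A j) fun j => b j) := by
  classical
  rw [integerHull]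
  congr 1
  ext x
  simp only [knapsackInter, Set.mem_inter_iff, Set.mem_iInter, Set.mem_image]
  constructor
  · rintro ⟨h1, h2⟩
    have hx : charVec (Finset.univ.filter fun i => x i = 1) = x := by
      ext i
      rcases h2 i with h | h <;> simp [charVec, h]
    refine ⟨_, fun j => ?_, hx⟩
    rw [← sum_mul_charVec, hx]
    exact (h1 j j.2).2
  · rintro ⟨T, hT, rfl⟩
    refine ⟨fun j hj => ⟨fun i => ⟨charVec_nonneg T i, charVec_le_one T i⟩, ?_⟩, fun i => ?_⟩
    · rw [sum_mul_charVec]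
      exact hT ⟨j, hj⟩
    · simp only [charVec]; split_ifs <;> simp

theorem update_mul_mem_convexHull {n : ℕ} {F : Set (Finset (Fin n))} (hF : IsLowerSet F)
    {x : Fin n → ℝ} (hx : x ∈ convexHull ℝ (charVec '' F)) (i : Fin n) {c : ℝ} (h0 : 0 ≤ c)
    (h1 : c ≤ 1) : Function.update x i (c * x i) ∈ convexHull ℝ (charVec '' F) := by
  have hlin : IsLinearMap ℝ fun x : Fin n → ℝ => Function.update x i (c * x i) := by
    constructor
    · intro x y
      ext k
      by_cases h : k = i
      · subst h; simp [mul_add]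
      · simp [h]
    · intro s x
      ext k
      by_cases h : k = i
      · subst h; simp [mul_left_comm]
      · simp [h]
  refine convexHull_min ?_ ((convex_convexHull ℝ (charVec '' F)).is_linear_preimage hlin) hx
  rintro _ ⟨T, hT, rfl⟩
  -- Scaling one coordinate of a vertex interpolates between the vertices of `T` and `T \ {i}`.
  have key : Function.update (charVec T) i (c * charVec T i) =
      c • charVec T + (1 - c) • charVec (T.erase i) := by
    ext k
    by_cases h : k = i
    · subst h; simp [charVec]
    · simp only [Function.update_of_ne h, charVec, Finset.mem_erase, ne_eq, h, not_false_eq_true,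
        true_and, Pi.add_apply, Pi.smul_apply, smul_eq_mul]
      ring
  rw [Set.mem_preimage, key]
  exact convex_convexHull ℝ _ (subset_convexHull ℝ _ (Set.mem_image_of_mem _ hT))
    (subset_convexHull ℝ _ (Set.mem_image_of_mem _ (hF (T.erase_subset i) hT)))
    h0 (by linarith) (by ring)

theorem mem_convexHull_of_le {n : ℕ} {F : Set (Finset (Fin n))} (hF : IsLowerSet F)
    {x y : Fin n → ℝ} (hx : x ∈ convexHull ℝ (charVec '' F)) (h0 : 0 ≤ y) (hyx : y ≤ x) :
    y ∈ convexHull ℝ (charVec '' F) := by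
  suffices h : ∀ s : Finset (Fin n),
      (fun i => if i ∈ s then y i else x i) ∈ convexHull ℝ (charVec '' F) by
    simpa using h Finset.univ
  intro s
  induction s using Finset.induction_on with
  | empty => simpa using hx
  | insert i s hi ih =>
    have hxi : 0 ≤ x i := (h0 i).trans (hyx i)
    have h := update_mul_mem_convexHull hF ih i (c := y i / x i) (div_nonneg (h0 i) hxi)
      (div_le_one_of_le₀ (hyx i) hxi)
    convert h using 1
    ext k
    by_cases hk : k = i
    · subst hk
      by_cases hz : x k = 0
      · have : y k = 0 := le_antisymm (hz ▸ hyx k) (h0 k)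
        simp [hi, hz, this]
      · simp [hi, div_mul_cancel₀ _ hz]
    · simp [hk]

/-! ### Rounding points with few fractional coordinates -/

/-- An extreme point of a box with `|R|` further constraints has at most `|R|` coordinates strictly
between their bounds: otherwise it could be moved both ways along the kernel of the constraints. -/
theorem card_fractional_le {n : ℕ} {R : Type*} [Fintype R] {a : R → Fin n → ℝ} {β : R → ℝ}
    {l u z : Fin n → ℝ} (hz : z ∈ (boxPolytope a β l u).extremePoints ℝ) :
    (Finset.univ.filter fun i => l i < z i ∧ z i < u i).card ≤ Fintype.card R := by
  classical
  by_contra! hlt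
  set F := Finset.univ.filter fun i => l i < z i ∧ z i < u i with hF
  let f : (F → ℝ) →ₗ[ℝ] (R → ℝ) :=
    LinearMap.pi fun r => ∑ i : F, a r i • LinearMap.proj i
  have hker : LinearMap.ker f ≠ ⊥ := LinearMap.ker_ne_bot_of_finrank_lt (by simpa using hlt)
  obtain ⟨v, hv, hv0⟩ := (Submodule.ne_bot_iff _).1 hker
  let w : Fin n → ℝ := fun i => if h : i ∈ F then v ⟨i, h⟩ else 0
  have hw : ∀ r, ∑ i, a r i * w i = 0 := by
    intro r
    have h := congrFun (LinearMap.mem_ker.1 hv) r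
    simp only [f, LinearMap.pi_apply, LinearMap.coe_sum, Finset.sum_apply, LinearMap.smul_apply,
      LinearMap.proj_apply, smul_eq_mul, Pi.zero_apply] at h
    rw [← h, ← Finset.sum_subset (Finset.subset_univ F) fun i _ hi => by simp [w, hi],
      ← Finset.sum_coe_sort]
    exact Finset.sum_congr rfl fun i _ => by simp [w]
  have hzP : z ∈ boxPolytope a β l u := extremePoints_subset hz
  have hev : ∀ᶠ s : ℝ in nhds 0, z + s • w ∈ boxPolytope a β l u := by
    have hbox : ∀ᶠ s : ℝ in nhds 0, ∀ i, l i ≤ z i + s * w i ∧ z i + s * w i ≤ u i := by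
      refine Filter.eventually_all.2 fun i => ?_
      by_cases hi : i ∈ F
      · have hc : Filter.Tendsto (fun s : ℝ => z i + s * w i) (nhds 0) (nhds (z i)) := by
          have : Continuous fun s : ℝ => z i + s * w i := by fun_prop
          simpa using this.tendsto 0
        have hi' := (Finset.mem_filter.1 hi).2
        filter_upwards [hc.eventually_const_lt hi'.1, hc.eventually_lt_const hi'.2] with s h1 h2
        exact ⟨h1.le, h2.le⟩
      · refine Filter.Eventually.of_forall fun s => ?_
        simpa [w, hi] using ⟨hzP.1 i, hzP.2.1 i⟩
    filter_upwards [hbox] with s hs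
    refine ⟨fun i => (hs i).1, fun i => (hs i).2, fun r => ?_⟩
    have : ∑ i, a r i * (z + s • w) i = ∑ i, a r i * z i + s * ∑ i, a r i * w i := by
      rw [Finset.mul_sum, ← Finset.sum_add_distrib]
      exact Finset.sum_congr rfl fun i _ => by simp; ring
    rw [this, hw, mul_zero, add_zero]
    exact hzP.2.2 r
  have hneg : Filter.Tendsto (fun s : ℝ => -s) (nhds 0) (nhds 0) := by
    simpa using (continuous_neg (G := ℝ)).tendsto 0
  obtain ⟨s, ⟨h1, h2⟩, hs⟩ := ((hev.and (hneg.eventually hev)).filter_mono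
    (nhdsWithin_le_nhds (s := Set.Ioi 0))).and self_mem_nhdsWithin |>.exists
  have hs : 0 < s := hs
  have hseg : z ∈ openSegment ℝ (z + s • w) (z + (-s) • w) := by
    refine ⟨1 / 2, 1 / 2, by norm_num, by norm_num, by norm_num, ?_⟩
    ext i
    simp
    ring
  have hzw : z + s • w = z := (mem_extremePoints.1 hz).2 _ h1 _ h2 hseg |>.1
  have hw0 : w = 0 := by
    have : s • w = 0 := by simpa using hzw
    exact (smul_eq_zero.1 this).resolve_left hs.ne'
  apply hv0
  ext ⟨i, hi⟩
  simpa [w, hi] using congrFun hw0 i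

/-- Rounding. Suppose that every constraint `r` comes with `g` disjoint groups `σ r (p, ·)` of `t`
items each that `z` contains in full, and that no fractional item is heavier in `r` than an item of
these groups. Deleting one group per constraint then makes room for all the (at most `t`)
fractional items. The `g` packings obtained in this way, together with the set of integral items,
have an average that dominates `(1 - ε) z`: every item of the support of `z` is missing in at most
`t` of these `g + 1` packings. -/
theorem smul_mem_convexHull_of_groups {n t g : ℕ} {R : Type*} [Fintype R] {ε : ℝ}
    (hR : Fintype.card R ≤ t) (ht : 1 ≤ t) (hε1 : ε ≤ 1) (hε : (t : ℝ) ≤ ε * (g + 1))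
    {a : R → Fin n → ℝ} {β : R → ℝ} (ha : ∀ r i, 0 ≤ a r i)
    {σ : R → Fin g × Fin t → Fin n} (hσ : ∀ r, Function.Injective (σ r))
    {z : Fin n → ℝ} (hz0 : 0 ≤ z) (hz1 : z ≤ 1) (hzσ : ∀ r p, z (σ r p) = 1)
    (hlight : ∀ i, 0 < z i → z i < 1 → ∀ r p, a r i ≤ a r (σ r p))
    (hfrac : (Finset.univ.filter fun i => 0 < z i ∧ z i < 1).card ≤ t)
    (hfeas : ∀ r, ∑ i, a r i * z i ≤ β r) :
    (1 - ε) • z ∈ convexHull ℝ (charVec '' packings a β) := by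
  classical
  set F := Finset.univ.filter fun i => 0 < z i ∧ z i < 1 with hF
  set O := Finset.univ.filter fun i => z i = 1 with hO
  let T : Option (Fin g) → Finset (Fin n) := fun o => o.elim O fun p =>
    (O \ Finset.univ.image fun q : R × Fin t => σ q.1 (p, q.2)) ∪ F
  have hOsum : ∀ r, ∑ i ∈ O, a r i ≤ β r := by
    intro r
    refine le_trans ?_ (hfeas r)
    calc ∑ i ∈ O, a r i = ∑ i ∈ O, a r i * z i :=
          Finset.sum_congr rfl fun i hi => by rw [(Finset.mem_filter.1 hi).2, mul_one]
      _ ≤ ∑ i, a r i * z i := Finset.sum_le_sum_of_subset_of_nonneg (Finset.subset_univ _)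
          fun i _ _ => mul_nonneg (ha r i) (hz0 i)
  have hT : ∀ o, T o ∈ packings a β := by
    rintro (_ | p) r
    · exact hOsum r
    · set G := Finset.univ.image fun q : Fin t => σ r (p, q) with hG
      have hinj : Function.Injective fun q : Fin t => σ r (p, q) := fun q q' h =>
        congrArg Prod.snd (hσ r h)
      have hGO : G ⊆ O := by
        intro i hi
        obtain ⟨q, -, rfl⟩ := Finset.mem_image.1 hi
        exact Finset.mem_filter.2 ⟨Finset.mem_univ _, hzσ r _⟩
      have hFG : ∑ i ∈ F, a r i ≤ ∑ i ∈ G, a r i := by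
        rcases F.eq_empty_or_nonempty with h | h
        · rw [h, Finset.sum_empty]
          exact Finset.sum_nonneg fun i _ => ha r i
        · obtain ⟨f, hf, hmax⟩ := F.exists_max_image (a r) h
          have hf' := (Finset.mem_filter.1 hf).2
          calc ∑ i ∈ F, a r i ≤ F.card • a r f := Finset.sum_le_card_nsmul _ _ _ hmax
            _ ≤ G.card • a r f := by
                refine nsmul_le_nsmul_left (ha r f) ?_
                rwa [hG, Finset.card_image_of_injective _ hinj, Finset.card_univ, Fintype.card_fin]
            _ ≤ ∑ i ∈ G, a r i := by
                refine Finset.card_nsmul_le_sum _ _ _ fun i hi => ?_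
                obtain ⟨q, -, rfl⟩ := Finset.mem_image.1 hi
                exact hlight f hf'.1 hf'.2 r _
      have hsub : T (some p) ⊆ (O \ G) ∪ F := by
        refine Finset.union_subset_union_left (Finset.sdiff_subset_sdiff le_rfl fun i hi => ?_)
        obtain ⟨q, -, rfl⟩ := Finset.mem_image.1 hi
        exact Finset.mem_image.2 ⟨(r, q), Finset.mem_univ _, rfl⟩
      calc ∑ i ∈ T (some p), a r i ≤ ∑ i ∈ (O \ G) ∪ F, a r i :=
            Finset.sum_le_sum_of_subset_of_nonneg hsub fun i _ _ => ha r i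
        _ ≤ ∑ i ∈ O \ G, a r i + ∑ i ∈ F, a r i := by
            rw [← Finset.sum_union_inter]
            exact le_add_of_nonneg_right (Finset.sum_nonneg fun i _ => ha r i)
        _ ≤ ∑ i ∈ O \ G, a r i + ∑ i ∈ G, a r i := by gcongr
        _ = ∑ i ∈ O, a r i := Finset.sum_sdiff hGO
        _ ≤ β r := hOsum r
  have hmiss : ∀ i, 0 < z i → (Finset.univ.filter fun o => i ∉ T o).card ≤ t := by
    intro i hi
    by_cases hi1 : z i < 1
    · refine le_trans (Finset.card_le_one.2 ?_) ht
      have : ∀ o, i ∉ T o → o = none := by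
        rintro (_ | p) ho
        · rfl
        · exact absurd (Finset.mem_union_right _ (Finset.mem_filter.2
            ⟨Finset.mem_univ _, hi, hi1⟩)) ho
      intro o ho o' ho'
      rw [this o (Finset.mem_filter.1 ho).2, this o' (Finset.mem_filter.1 ho').2]
    · have hiO : i ∈ O :=
        Finset.mem_filter.2 ⟨Finset.mem_univ _, le_antisymm (hz1 i) (not_lt.1 hi1)⟩
      refine le_trans ?_ hR
      refine Finset.card_le_card_of_forall_subsingleton
        (fun (o : Option (Fin g)) (r : R) => ∃ p q, o = some p ∧ σ r (p, q) = i) ?_ ?_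
      · rintro (_ | p) ho
        · exact absurd hiO (Finset.mem_filter.1 ho).2
        · have h : i ∉ O \ Finset.univ.image fun q : R × Fin t => σ q.1 (p, q.2) := fun h =>
            (Finset.mem_filter.1 ho).2 (Finset.mem_union_left _ h)
          simp only [Finset.mem_sdiff, hiO, true_and, not_not, Finset.mem_image,
            Finset.mem_univ] at h
          obtain ⟨⟨r, q⟩, hq⟩ := h
          exact ⟨r, Finset.mem_univ _, p, q, rfl, hq⟩
      · rintro r - o ⟨-, p, q, rfl, h⟩ o' ⟨-, p', q', rfl, h'⟩
        exact congrArg some (congrArg Prod.fst (hσ r (h.trans h'.symm)))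
  have hg : (0 : ℝ) < g + 1 := by positivity
  refine mem_convexHull_of_le (isLowerSet_packings ha)
    (x := ∑ o, ((g : ℝ) + 1)⁻¹ • charVec (T o)) ?_ ?_ ?_
  · refine (convex_convexHull ℝ _).sum_mem (fun _ _ => by positivity) ?_
      fun o _ => subset_convexHull ℝ _ ⟨_, hT o, rfl⟩
    rw [Finset.sum_const, Finset.card_univ, Fintype.card_option, Fintype.card_fin, nsmul_eq_mul]
    push_cast
    exact mul_inv_cancel₀ hg.ne'
  · exact smul_nonneg (by linarith) hz0
  · intro i
    rw [Finset.sum_apply, Pi.smul_apply, smul_eq_mul]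
    simp only [Pi.smul_apply, smul_eq_mul]
    rw [← Finset.mul_sum]
    rcases (hz0 i).eq_or_lt with hi | hi
    · rw [← hi, Pi.zero_apply, mul_zero]
      exact mul_nonneg (by positivity) (Finset.sum_nonneg fun o _ => charVec_nonneg _ i)
    · have hcount : ((Finset.univ.filter fun o => i ∈ T o).card : ℝ)
          + (Finset.univ.filter fun o => i ∉ T o).card = g + 1 := by
        have h := Finset.card_filter_add_card_filter_not
          (s := (Finset.univ : Finset (Option (Fin g)))) fun o => i ∈ T o
        rw [Finset.card_univ, Fintype.card_option, Fintype.card_fin] at h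
        exact_mod_cast h
      have hm : ((Finset.univ.filter fun o => i ∉ T o).card : ℝ) ≤ t := by
        exact_mod_cast hmiss i hi
      have hsum : ∑ o, charVec (T o) i = (Finset.univ.filter fun o => i ∈ T o).card := by
        simp [charVec]
      rw [hsum, le_inv_mul_iff₀ hg]
      have h1 : (1 - ε) * z i ≤ 1 - ε := mul_le_of_le_one_right (by linarith) (hz1 i)
      nlinarith

/-! ### The approximate formulation of an integer hull -/

/-- By the Krein–Milman theorem, a closed convex set that contains the dilates `c • z` of the
extreme points `z` of a polytope contains the dilates of all its points. -/
theorem smul_mem_of_extremePoints {n : ℕ} {R : Type*} {a : R → Fin n → ℝ} {β : R → ℝ}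
    {l u : Fin n → ℝ} {Y : Set (Fin n → ℝ)} (hY : Convex ℝ Y) (hYc : IsClosed Y) (c : ℝ)
    (h : ∀ z ∈ (boxPolytope a β l u).extremePoints ℝ, c • z ∈ Y) :
    ∀ z ∈ boxPolytope a β l u, c • z ∈ Y := by
  have hcomp : IsCompact (boxPolytope a β l u) := by
    refine (isCompact_Icc (a := l) (b := u)).of_isClosed_subset ?_ fun x hx => ⟨hx.1, hx.2.1⟩
    simp only [boxPolytope, Set.ofPred_and, Set.ofPred_forall]
    exact (isClosed_le (by fun_prop) (by fun_prop)).inter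
      ((isClosed_le (by fun_prop) (by fun_prop)).inter
        (isClosed_iInter fun r => isClosed_le (by fun_prop) (by fun_prop)))
  have hconv : Convex ℝ (boxPolytope a β l u) := by
    rintro x ⟨h1, h2, h3⟩ y ⟨h4, h5, h6⟩ p q hp hq hpq
    have hbox := convex_Icc l u ⟨h1, h2⟩ ⟨h4, h5⟩ hp hq hpq
    refine ⟨hbox.1, hbox.2, fun r => ?_⟩
    have h7 := add_le_add (mul_le_mul_of_nonneg_left (h3 r) hp)
      (mul_le_mul_of_nonneg_left (h6 r) hq)
    rw [← add_mul, hpq, one_mul] at h7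
    refine le_trans (le_of_eq ?_) h7
    rw [Finset.mul_sum, Finset.mul_sum, ← Finset.sum_add_distrib]
    exact Finset.sum_congr rfl fun i _ => by simp; ring
  intro z hz
  rw [← closure_convexHull_extremePoints hcomp hconv] at hz
  refine closure_minimal (convexHull_min h (hY.smul_preimage c)) ?_ hz
  exact hYc.preimage (continuous_const_smul c)

theorem exists_heaviest_subset {α : Type*} [DecidableEq α] (f : α → ℝ) (T : Finset α) {k : ℕ}
    (hk : k ≤ T.card) :
    ∃ U ⊆ T, U.card = k ∧ ∀ i ∈ T \ U, ∀ j ∈ U, f i ≤ f j := by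
  induction k with
  | zero => exact ⟨∅, by simp, by simp, by simp⟩
  | succ k ih =>
    obtain ⟨U, hUT, hU, hmax⟩ := ih (by lia)
    have hne : (T \ U).Nonempty := by
      rw [← Finset.card_pos, Finset.card_sdiff_of_subset hUT]
      lia
    obtain ⟨v, hv, hvmax⟩ := (T \ U).exists_max_image f hne
    have hv' := Finset.mem_sdiff.1 hv
    refine ⟨insert v U, Finset.insert_subset hv'.1 hUT, by
      rw [Finset.card_insert_of_notMem hv'.2, hU], fun i hi j hj => ?_⟩
    have hi' : i ∈ T \ U :=
      Finset.sdiff_subset_sdiff le_rfl (Finset.subset_insert v U) hi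
    rcases Finset.mem_insert.1 hj with rfl | hj
    · exact hvmax i hi'
    · exact hmax i hi' j hj

section Guess

variable {n t g : ℕ} {R : Type*} [Fintype R]

/-- The disjuncts of the approximate formulation. A disjunct is either a guess of the `g * t`
heaviest items for every constraint, arranged in `g` groups of `t`, or (the code of) a set of at
most `g * t` items; `none` stands for the empty set. -/
abbrev Guess (n t g : ℕ) (R : Type*) : Type _ :=
  {σ : R → Fin g × Fin t → Fin n // ∀ r, Function.Injective (σ r)} ⊕
    Option (Fin g × Fin t → Fin n)

/-- The items that belong to some guessed group. -/
def guessed (σ : R → Fin g × Fin t → Fin n) : Finset (Fin n) :=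
  Finset.univ.image fun q : R × Fin g × Fin t => σ q.1 q.2

/-- The set of items encoded by an optional tuple. -/
def smallSet (τ : Option (Fin g × Fin t → Fin n)) : Finset (Fin n) :=
  τ.elim ∅ fun τ => Finset.univ.image τ

open Classical in
/-- The items that a disjunct does not fix to `0`: the guessed ones, and those that are in no
constraint heavier than an item guessed for this constraint. -/
noncomputable def allowed (a : R → Fin n → ℝ) (σ : R → Fin g × Fin t → Fin n) : Finset (Fin n) :=
  guessed σ ∪ Finset.univ.filter fun i => ∀ r p, a r i ≤ a r (σ r p)

/-- The vector of lower bounds of a disjunct. -/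
noncomputable def guessLower : Guess n t g R → Fin n → ℝ :=
  Sum.elim (fun σ => charVec (guessed σ.1)) fun τ => charVec (smallSet τ)

/-- The vector of upper bounds of a disjunct. -/
noncomputable def guessUpper (a : R → Fin n → ℝ) : Guess n t g R → Fin n → ℝ :=
  Sum.elim (fun σ => charVec (allowed a σ.1)) fun τ => charVec (smallSet τ)

theorem charVec_mono {S T : Finset (Fin n)} (h : S ⊆ T) : charVec S ≤ charVec T := fun i => by
  by_cases hi : i ∈ S
  · simp [charVec, hi, h hi]
  · simpa [charVec, hi] using charVec_nonneg T i

/-- Every packing lies in a disjunct: the one of its heaviest items for every constraint if it has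
at least `g * t` items, and its own singleton otherwise. -/
theorem exists_guess {a : R → Fin n → ℝ} {β : R → ℝ} {T : Finset (Fin n)}
    (hT : T ∈ packings a β) :
    ∃ d : Guess n t g R, charVec T ∈ boxPolytope a β (guessLower d) (guessUpper a d) := by
  classical
  have hrows : ∀ r, ∑ i, a r i * charVec T i ≤ β r := fun r => by
    rw [sum_mul_charVec]; exact hT r
  by_cases hcard : g * t ≤ T.card
  · choose U hUT hU hmax using fun r => exists_heaviest_subset (a r) T hcard
    let e : ∀ r, Fin g × Fin t ≃ U r := fun r => Fintype.equivOfCardEq (by simp [hU])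
    have hσ : ∀ r, Function.Injective fun p => (e r p : Fin n) := fun r =>
      Subtype.val_injective.comp (e r).injective
    refine ⟨Sum.inl ⟨fun r p => e r p, hσ⟩, charVec_mono fun i hi => ?_,
      charVec_mono fun i hi => ?_, hrows⟩
    · obtain ⟨q, -, rfl⟩ := Finset.mem_image.1 hi
      exact hUT _ (e q.1 q.2).2
    · by_cases h : i ∈ guessed fun r p => (e r p : Fin n)
      · exact Finset.mem_union_left _ h
      · refine Finset.mem_union_right _ (Finset.mem_filter.2 ⟨Finset.mem_univ _, fun r p => ?_⟩)
        refine hmax r i (Finset.mem_sdiff.2 ⟨hi, fun hiU => h ?_⟩) _ (e r p).2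
        exact Finset.mem_image.2 ⟨(r, (e r).symm ⟨i, hiU⟩), Finset.mem_univ _, by simp⟩
  · obtain ⟨τ, rfl⟩ : ∃ τ : Option (Fin g × Fin t → Fin n), smallSet τ = T := by
      rcases T.eq_empty_or_nonempty with rfl | ⟨i, hi⟩
      · exact ⟨none, rfl⟩
      · have hle : Fintype.card T ≤ Fintype.card (Fin g × Fin t) := by
          simpa using (not_le.1 hcard).le
        obtain ⟨e⟩ := Function.Embedding.nonempty_of_card_le hle
        have : Nonempty T := ⟨⟨i, hi⟩⟩
        refine ⟨some fun p => ((Function.invFun e p : T) : Fin n), ?_⟩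
        ext k
        simp only [smallSet, Option.elim_some, Finset.mem_image, Finset.mem_univ, true_and]
        constructor
        · rintro ⟨p, rfl⟩
          exact (Function.invFun e p).2
        · intro hk
          exact ⟨e ⟨k, hk⟩, by rw [Function.leftInverse_invFun e.injective]⟩
    exact ⟨Sum.inr τ, le_rfl, le_rfl, hrows⟩

theorem card_guess_le (hn : 1 ≤ n) (ht : 1 ≤ t) (hR : Fintype.card R = t) [DecidableEq R] :
    Fintype.card (Guess n t g R) ≤ 3 * n ^ (t * (g * t)) := by
  classical
  have h1 : Fintype.card {σ : R → Fin g × Fin t → Fin n // ∀ r, Function.Injective (σ r)} ≤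
      n ^ (t * (g * t)) := by
    refine (Fintype.card_subtype_le _).trans (le_of_eq ?_)
    simp [hR, ← pow_mul, mul_comm]
  have h2 : n ^ (g * t) ≤ n ^ (t * (g * t)) :=
    Nat.pow_le_pow_right hn (Nat.le_mul_of_pos_left _ ht)
  have h3 : 1 ≤ n ^ (t * (g * t)) := Nat.one_le_pow _ _ hn
  simp only [Guess, Fintype.card_sum, Fintype.card_option, Fintype.card_fun, Fintype.card_prod,
    Fintype.card_fin]
  lia

/-- Every point of a disjunct, scaled by `1 - ε`, lies in the integer hull. -/
theorem smul_mem_convexHull_of_guess {ε : ℝ} (hR : Fintype.card R ≤ t) (ht : 1 ≤ t) (hε0 : 0 ≤ ε)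
    (hε1 : ε ≤ 1) (hε : (t : ℝ) ≤ ε * (g + 1)) {a : R → Fin n → ℝ} {β : R → ℝ}
    (ha : ∀ r i, 0 ≤ a r i) (d : Guess n t g R) :
    ∀ z ∈ boxPolytope a β (guessLower d) (guessUpper a d),
      (1 - ε) • z ∈ convexHull ℝ (charVec '' packings a β) := by
  classical
  rcases d with ⟨σ, hσ⟩ | τ
  · refine smul_mem_of_extremePoints (convex_convexHull ℝ _)
      ((Set.toFinite _).isClosed_convexHull ℝ) _ fun z hz => ?_
    obtain ⟨hl, hu, hrow⟩ := extremePoints_subset hz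
    simp only [guessLower, guessUpper, Sum.elim_inl] at hl hu hrow
    have hfracbound : ∀ i, 0 < z i → z i < 1 →
        charVec (guessed σ) i < z i ∧ z i < charVec (allowed a σ) i := by
      intro i h0 h1
      have hli := hl i
      have hui := hu i
      simp only [charVec] at hli hui ⊢
      constructor
      · split_ifs at hli ⊢ <;> linarith
      · split_ifs at hui ⊢ <;> linarith
    refine smul_mem_convexHull_of_groups hR ht hε1 hε ha hσ ((charVec_nonneg _).trans hl)
      (hu.trans (charVec_le_one _)) (fun r p => ?_) (fun i h0 h1 r p => ?_) ?_ hrow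
    · have hmem : σ r p ∈ guessed σ := Finset.mem_image.2 ⟨(r, p), Finset.mem_univ _, rfl⟩
      have h1 := hl (σ r p)
      have h2 := (hu (σ r p)).trans (charVec_le_one _ _)
      rw [charVec, if_pos hmem] at h1
      exact le_antisymm h2 h1
    · obtain ⟨h2, h3⟩ := hfracbound i h0 h1
      have hng : i ∉ guessed σ := fun h => by rw [charVec, if_pos h] at h2; linarith
      have hal : i ∈ allowed a σ := by
        by_contra h
        rw [charVec, if_neg h] at h3; linarith
      exact (Finset.mem_filter.1 ((Finset.mem_union.1 hal).resolve_left hng)).2 r p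
    · refine le_trans (Finset.card_le_card fun i hi => ?_) ((card_fractional_le hz).trans hR)
      obtain ⟨-, h0, h1⟩ := Finset.mem_filter.1 hi
      exact Finset.mem_filter.2 ⟨Finset.mem_univ _, hfracbound i h0 h1⟩
  · rintro z ⟨hl, hu, hrow⟩
    simp only [guessLower, guessUpper, Sum.elim_inr] at hl hu
    obtain rfl : z = charVec (smallSet τ) := le_antisymm hu hl
    have hmem : smallSet τ ∈ packings a β := fun r => by
      rw [← sum_mul_charVec]; exact hrow r
    refine mem_convexHull_of_le (isLowerSet_packings ha)
      (subset_convexHull ℝ _ (Set.mem_image_of_mem _ hmem))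
      (smul_nonneg (by linarith) (charVec_nonneg _)) ?_
    exact smul_le_of_le_one_left (charVec_nonneg _) (by linarith)

end Guess

section Formulation

variable {n t : ℕ} {R : Type*} {ε : ℝ} {a : R → Fin n → ℝ} {β : R → ℝ}

/-- For `t³ / ε ≥ n` the integer hull has few enough vertices to be described exactly, as the
convex hull of the at most `2ⁿ` packings. -/
theorem exists_formulation_of_le (hn : 1 ≤ n) (hle : (n : ℝ) ≤ (t : ℝ) ^ 3 / ε) (hε0 : 0 ≤ ε)
    (hε1 : ε ≤ 1) (ha : ∀ r i, 0 ≤ a r i) (hβ : ∀ r, 0 ≤ β r) :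
    ∃ K : ExtendedFormulation n, K.IsApprox ε (convexHull ℝ (charVec '' packings a β)) ∧
      IsCompact K.proj ∧ (K.size : ℝ) ≤ 33 * (n : ℝ) ^ ((t : ℝ) ^ 3 / ε + 1) := by
  classical
  let D := {T // T ∈ packings a β}
  let v : D → Fin n → ℝ := fun T => charVec T.1
  let a' : Fin 0 → Fin n → ℝ := 0
  let β' : Fin 0 → ℝ := 0
  have : Nonempty D := ⟨⟨∅, empty_mem_packings hβ⟩⟩
  refine ⟨disjunctiveFormulation a' β' v v, ⟨?_, ?_⟩,
    isCompact_proj_disjunctiveFormulation _ _ _ _ (fun _ => charVec_nonneg _)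
      (fun _ => charVec_le_one _), ?_⟩
  · refine smul_mem_of_mem_proj _ _ _ _ (convex_convexHull ℝ _) _ ?_
    rintro ⟨T, hT⟩ x ⟨h1, h2, -⟩
    obtain rfl : x = charVec T := le_antisymm h2 h1
    exact mem_convexHull_of_le (isLowerSet_packings ha)
      (subset_convexHull ℝ _ (Set.mem_image_of_mem _ hT))
      (smul_nonneg (by linarith) (charVec_nonneg _))
      (smul_le_of_le_one_left (charVec_nonneg _) (by linarith))
  · refine convexHull_min ?_ (ExtendedFormulation.convex_proj _)
    rintro _ ⟨T, hT, rfl⟩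
    exact boxPolytope_subset_proj a' β' v v ⟨T, hT⟩ ⟨le_rfl, le_rfl, fun r => r.elim0⟩
  · have hsize := size_disjunctiveFormulation_le a' β' v v hn (by simp)
    have hD : Fintype.card D ≤ 2 ^ n := by
      refine (Fintype.card_subtype_le _).trans (le_of_eq ?_)
      simp
    have hn0 : (0 : ℝ) < n := by exact_mod_cast hn
    have hpow : (2 : ℝ) ^ n ≤ 2 * (n : ℝ) ^ ((t : ℝ) ^ 3 / ε) := by
      rcases hn.eq_or_lt with rfl | hn2
      · simp
      · have h2 : (2 : ℝ) ≤ n := by exact_mod_cast hn2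
        calc (2 : ℝ) ^ n ≤ (n : ℝ) ^ n := by gcongr
          _ = (n : ℝ) ^ (n : ℝ) := (Real.rpow_natCast _ _).symm
          _ ≤ (n : ℝ) ^ ((t : ℝ) ^ 3 / ε) :=
              Real.rpow_le_rpow_of_exponent_le (by linarith) hle
          _ ≤ 2 * (n : ℝ) ^ ((t : ℝ) ^ 3 / ε) := by
              linarith [Real.rpow_nonneg hn0.le ((t : ℝ) ^ 3 / ε)]
    rw [Real.rpow_add_one hn0.ne']
    calc ((disjunctiveFormulation a' β' v v).size : ℝ) ≤ 11 * (n * Fintype.card D) := by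
          exact_mod_cast hsize
      _ ≤ 11 * (n * 2 ^ n) := by gcongr; exact_mod_cast hD
      _ ≤ 11 * (n * (2 * (n : ℝ) ^ ((t : ℝ) ^ 3 / ε))) := by gcongr
      _ ≤ 33 * ((n : ℝ) ^ ((t : ℝ) ^ 3 / ε) * n) := by
          nlinarith [mul_nonneg (Real.rpow_nonneg hn0.le ((t : ℝ) ^ 3 / ε)) hn0.le]

/-- For `t³ / ε < n`, guessing heaviest items gives a small approximate formulation. The number of
groups is `⌈t / ε⌉ - 1`: the least `g` with `t ≤ ε (g + 1)`, which also satisfies `g ≤ t / ε`. -/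
theorem exists_formulation_of_lt [Fintype R] (hR : Fintype.card R = t) (ht : 1 ≤ t)
    (hlt : (t : ℝ) ^ 3 / ε < n) (hε0 : 0 < ε) (hε1 : ε ≤ 1) (ha : ∀ r i, 0 ≤ a r i) :
    ∃ K : ExtendedFormulation n, K.IsApprox ε (convexHull ℝ (charVec '' packings a β)) ∧
      IsCompact K.proj ∧ (K.size : ℝ) ≤ 33 * (n : ℝ) ^ ((t : ℝ) ^ 3 / ε + 1) := by
  classical
  set g := ⌈(t : ℝ) / ε⌉₊ - 1 with hg
  have ht1 : (1 : ℝ) ≤ t := by exact_mod_cast ht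
  have hpos : 0 < (t : ℝ) / ε := by positivity
  have hg1 : ((g : ℝ) + 1) = ⌈(t : ℝ) / ε⌉₊ := by
    have : g + 1 = ⌈(t : ℝ) / ε⌉₊ := Nat.sub_add_cancel (Nat.ceil_pos.2 hpos)
    exact_mod_cast this
  have hε : (t : ℝ) ≤ ε * (g + 1) := by
    rw [hg1, ← div_le_iff₀' hε0]
    exact Nat.le_ceil _
  have hgle : (g : ℝ) ≤ t / ε := by
    linarith [Nat.ceil_lt_add_one hpos.le]
  have htn : (t : ℝ) ≤ n := by
    refine le_trans ?_ hlt.le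
    rw [le_div_iff₀ hε0]
    have h3 : (t : ℝ) ≤ (t : ℝ) ^ 3 := le_self_pow₀ ht1 (by norm_num)
    nlinarith
  have htn' : t ≤ n := by exact_mod_cast htn
  have hn : 1 ≤ n := ht.trans htn'
  have hn1 : (1 : ℝ) ≤ n := ht1.trans htn
  let l : Guess n t g R → Fin n → ℝ := guessLower
  let u : Guess n t g R → Fin n → ℝ := guessUpper a
  have : Nonempty (Guess n t g R) := ⟨Sum.inr none⟩
  refine ⟨disjunctiveFormulation a β l u, ⟨?_, ?_⟩,
    isCompact_proj_disjunctiveFormulation _ _ _ _ ?_ ?_, ?_⟩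
  · exact smul_mem_of_mem_proj _ _ _ _ (convex_convexHull ℝ _) _
      (smul_mem_convexHull_of_guess hR.le ht hε0.le hε1 hε ha)
  · refine convexHull_min ?_ (ExtendedFormulation.convex_proj _)
    rintro _ ⟨T, hT, rfl⟩
    obtain ⟨d, hd⟩ := exists_guess (t := t) (g := g) hT
    exact boxPolytope_subset_proj a β l u d hd
  · rintro (σ | τ) <;> exact charVec_nonneg _
  · rintro (σ | τ) <;> exact charVec_le_one _
  · have hsize := size_disjunctiveFormulation_le a β l u hn (hR.trans_le htn')
    have hcard := card_guess_le (g := g) hn ht hR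
    have hexp : ((t * (g * t) : ℕ) : ℝ) ≤ (t : ℝ) ^ 3 / ε := by
      push_cast
      calc (t : ℝ) * (g * t) ≤ t * (t / ε * t) := by gcongr
        _ = (t : ℝ) ^ 3 / ε := by ring
    rw [Real.rpow_add_one (by linarith)]
    calc ((disjunctiveFormulation a β l u).size : ℝ)
        ≤ 11 * (n * Fintype.card (Guess n t g R)) := by exact_mod_cast hsize
      _ ≤ 11 * (n * (3 * (n : ℝ) ^ (t * (g * t)))) := by gcongr; exact_mod_cast hcard
      _ = 33 * ((n : ℝ) ^ ((t * (g * t) : ℕ) : ℝ) * n) := by rw [Real.rpow_natCast]; ring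
      _ ≤ 33 * ((n : ℝ) ^ ((t : ℝ) ^ 3 / ε) * n) := by
          gcongr

theorem exists_formulation [Fintype R] (hR : Fintype.card R = t) (ht : 1 ≤ t) (hε0 : 0 < ε)
    (hε1 : ε ≤ 1) (ha : ∀ r i, 0 ≤ a r i) (hβ : ∀ r, 0 ≤ β r) :
    ∃ K : ExtendedFormulation n, K.IsApprox ε (convexHull ℝ (charVec '' packings a β)) ∧
      IsCompact K.proj ∧ (K.size : ℝ) ≤ 33 * (n : ℝ) ^ ((t : ℝ) ^ 3 / ε + 1) := by
  rcases Nat.eq_zero_or_pos n with rfl | hn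
  -- In dimension `0` the bound on the size is `0`, which only the empty system meets.
  · have hpos : (0 : ℝ) < (t : ℝ) ^ 3 / ε + 1 := by positivity
    refine ⟨⟨0, 0, 0, 0, 0⟩, ⟨fun x _ => ?_, fun x _ => ⟨0, fun i => i.elim0⟩⟩,
      Set.subsingleton_of_subsingleton.isCompact, ?_⟩
    · rw [Subsingleton.elim ((1 - ε) • x) (charVec ∅)]
      exact subset_convexHull ℝ _ (Set.mem_image_of_mem _ (empty_mem_packings hβ))
    · simp [ExtendedFormulation.size, Real.zero_rpow hpos.ne']
  · rcases le_or_gt (n : ℝ) ((t : ℝ) ^ 3 / ε) with h | h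
    · exact exists_formulation_of_le hn h hε0.le hε1 ha hβ
    · exact exists_formulation_of_lt hR ht h hε0 hε1 ha

end Formulation

/-! ### The hierarchy -/

theorem isCompact_iInter_of_nonempty {X ι : Type*} [TopologicalSpace X] [T2Space X] [Nonempty ι]
    {s : ι → Set X} (hs : ∀ i, IsCompact (s i)) : IsCompact (⋂ i, s i) :=
  (hs (Classical.arbitrary ι)).of_isClosed_subset (isClosed_iInter fun i => (hs i).isClosed)
    (Set.iInter_subset _ _)

theorem exists_isGreatest_image {n : ℕ} {X : Set (Fin n → ℝ)} (hX : IsCompact X)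
    (hne : X.Nonempty) (w : Fin n → ℝ) :
    ∃ v, IsGreatest ((fun x : Fin n → ℝ => ∑ i, w i * x i) '' X) v :=
  (hX.image (by fun_prop)).exists_isGreatest (hne.image _)

end KnapsackHierarchy

open KnapsackHierarchy

theorem mainTheorem4 :
    ∃ C : ℝ, 0 < C ∧
      ∀ (t n m : ℕ) (ε : ℝ), 1 ≤ t → t ≤ m → 0 < ε → ε ≤ 1 →
      ∀ (A : Matrix (Fin m) (Fin n) ℝ) (b : Fin m → ℝ),
        (∀ j i, 0 ≤ A j i) → (∀ j, 0 ≤ b j) →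
      ∃ (K : {S : Finset (Fin m) // S.card = t} → KnapsackHierarchy.ExtendedFormulation n)
        (Q : KnapsackHierarchy.ExtendedFormulation n),
        -- approximate extended formulations of the integer hulls `K_I(S)`
        (∀ S, (K S).IsApprox ε (KnapsackHierarchy.integerHull A b S.1) ∧
          ((K S).size : ℝ) ≤ C * (n : ℝ) ^ ((t : ℝ) ^ 3 / ε + 1)) ∧
        -- `Q` is their intersection, and it approximates `P^t`
        Q.proj = ⋂ S, (K S).proj ∧
        Q.IsApprox ε (KnapsackHierarchy.hierarchy A b t) ∧
        -- the size of `Q`, for any number `m` of rows, and for `m ≤ c n`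
        (Q.size : ℝ) ≤ C * (m : ℝ) ^ t * (n : ℝ) ^ ((t : ℝ) ^ 3 / ε + 1) ∧
        (∀ c : ℝ, (m : ℝ) ≤ c * n →
          (Q.size : ℝ) ≤ C * c ^ t * (n : ℝ) ^ ((t : ℝ) ^ 3 / ε + t + 1)) ∧
        -- both optima are attained, and they compare as claimed
        (∀ w : Fin n → ℝ, (∀ i, 0 ≤ w i) →
          ∃ vP vQ : ℝ,
            IsGreatest ((fun x : Fin n → ℝ => ∑ i, w i * x i) ''
              KnapsackHierarchy.hierarchy A b t) vP ∧
            IsGreatest ((fun x : Fin n → ℝ => ∑ i, w i * x i) '' Q.proj) vQ ∧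
            vP ≤ vQ ∧ (1 - ε) * vQ ≤ vP ∧ (ε < 1 → vQ ≤ 1 / (1 - ε) * vP)) := by
  classical
  refine ⟨33, by norm_num, ?_⟩
  intro t n m ε ht htm hε0 hε1 A b hA hb
  have hK : ∀ S : {S : Finset (Fin m) // S.card = t}, ∃ K : ExtendedFormulation n,
      K.IsApprox ε (integerHull A b S.1) ∧ IsCompact K.proj ∧
        (K.size : ℝ) ≤ 33 * (n : ℝ) ^ ((t : ℝ) ^ 3 / ε + 1) := by
    intro S
    rw [integerHull_eq]
    exact exists_formulation (by simp [S.2]) ht hε0 hε1 (fun j i => hA j i) (fun j => hb j)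
  choose K happrox hcompact hsize using hK
  obtain ⟨S₀, -, hS₀⟩ := Finset.exists_subset_card_eq
    (s := (Finset.univ : Finset (Fin m))) (n := t) (by simpa using htm)
  have hne : Nonempty {S : Finset (Fin m) // S.card = t} := ⟨⟨S₀, hS₀⟩⟩
  have hproj := ExtendedFormulation.proj_inter K
  have hQ : (ExtendedFormulation.inter K).IsApprox ε (hierarchy A b t) := by
    rw [ExtendedFormulation.IsApprox, hproj]
    exact ⟨fun x hx => Set.mem_iInter.2 fun S => (happrox S).1 x (Set.mem_iInter.1 hx S),
      Set.iInter_mono fun S => (happrox S).2⟩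
  have hQsize : ((ExtendedFormulation.inter K).size : ℝ) ≤
      33 * (m : ℝ) ^ t * (n : ℝ) ^ ((t : ℝ) ^ 3 / ε + 1) := by
    have hcard : Fintype.card {S : Finset (Fin m) // S.card = t} ≤ m ^ t := by
      rw [Fintype.card_finset_len, Fintype.card_fin]
      exact Nat.choose_le_pow m t
    calc ((ExtendedFormulation.inter K).size : ℝ) ≤ ∑ S, ((K S).size : ℝ) := by
          exact_mod_cast ExtendedFormulation.size_inter_le K
      _ ≤ ∑ _S : {S : Finset (Fin m) // S.card = t},
            33 * (n : ℝ) ^ ((t : ℝ) ^ 3 / ε + 1) := Finset.sum_le_sum fun S _ => hsize S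
      _ = Fintype.card {S : Finset (Fin m) // S.card = t} *
            (33 * (n : ℝ) ^ ((t : ℝ) ^ 3 / ε + 1)) := by
          rw [Finset.sum_const, nsmul_eq_mul, Finset.card_univ]
      _ ≤ (m : ℝ) ^ t * (33 * (n : ℝ) ^ ((t : ℝ) ^ 3 / ε + 1)) := by
          gcongr
          exact_mod_cast hcard
      _ = _ := by ring
  have hm : (0 : ℝ) < m := by exact_mod_cast (show 0 < m by lia)
  refine ⟨K, ExtendedFormulation.inter K, fun S => ⟨happrox S, hsize S⟩, hproj, hQ, hQsize,
    fun c hc => hQsize.trans ?_, fun w hw => ?_⟩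
  · have hn : (0 : ℝ) < n := by
      refine lt_of_le_of_ne (Nat.cast_nonneg n) fun h => ?_
      rw [← h, mul_zero] at hc
      linarith
    calc 33 * (m : ℝ) ^ t * (n : ℝ) ^ ((t : ℝ) ^ 3 / ε + 1)
        ≤ 33 * (c * n) ^ t * (n : ℝ) ^ ((t : ℝ) ^ 3 / ε + 1) := by gcongr
      _ = 33 * c ^ t * (n : ℝ) ^ ((t : ℝ) ^ 3 / ε + t + 1) := by
          rw [mul_pow, show (t : ℝ) ^ 3 / ε + t + 1 = ((t : ℝ) ^ 3 / ε + 1) + t by ring,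
            Real.rpow_add hn _ (t : ℝ), Real.rpow_natCast]
          ring
  · have hPne : (hierarchy A b t).Nonempty := by
      refine ⟨charVec ∅, Set.mem_iInter.2 fun S => ?_⟩
      rw [integerHull_eq]
      exact subset_convexHull ℝ _ (Set.mem_image_of_mem _ (empty_mem_packings fun j => hb j))
    have hPcompact : IsCompact (hierarchy A b t) := by
      refine isCompact_iInter_of_nonempty fun S => ?_
      rw [integerHull_eq]
      exact (Set.toFinite _).isCompact_convexHull ℝ
    have hQcompact : IsCompact (ExtendedFormulation.inter K).proj := by
      rw [hproj]
      exact isCompact_iInter_of_nonempty hcompact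
    obtain ⟨vP, hvP⟩ := exists_isGreatest_image hPcompact hPne w
    obtain ⟨vQ, hvQ⟩ := exists_isGreatest_image hQcompact (hPne.mono hQ.2) w
    have hle : (1 - ε) * vQ ≤ vP := by
      obtain ⟨x, hx, rfl⟩ := hvQ.1
      refine hvP.2 ⟨(1 - ε) • x, hQ.1 x hx, ?_⟩
      simp only [Pi.smul_apply, smul_eq_mul, Finset.mul_sum]
      exact Finset.sum_congr rfl fun i _ => by ring
    refine ⟨vP, vQ, hvP, hvQ, hvQ.2 (Set.image_mono hQ.2 hvP.1), hle, fun h => ?_⟩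
    rw [one_div, le_inv_mul_iff₀ (by linarith)]
    exact hle
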